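/- Let $n\ge 1$ and let $P$ be a partial order on $[n]=\{1,\dots,n\}$. For $X\subseteq[n]$ and $\varepsilon\in\{-1,1\}^X$ put $\mathbf e_X^{\varepsilon}=\sum_{i\in X}\varepsilon_i\mathbf e_i\in\mathbb R^n$ and $\mathbf e_X=\sum_{i\in X}\mathbf e_i$. The enriched chain polytope $\mathcal C^{(e)}_P$ is the convex hull of all $\mathbf e_A^{\varepsilon}$ with $A$ an antichain of $P$ (possibly empty) and $\varepsilon\in\{-1,1\}^A$. The enriched order polytope $\mathcal O^{(e)}_P$ is the convex hull of all $\mathbf e_{\min(F)}^{\varepsilon}+\mathbf e_{F\setminus\min(F)}$ with $F$ a filter (upward closed subset, possibly empty) of $P$, $\min(F)$ its set of minimal elements, and $\varepsilon\in\{-1,1\}^{\min(F)}$. Define $$ b(n)=\begin{cases} 2n & \text{if } n=1,2,3,\\ \frac{47}{2}\cdot 3^{k-2}-\frac32 & \text{if } n=3k,\ k\ge 2,\\ \frac{23}{2}\cdot 3^{k-1}-\frac32 & \text{if } n=3k+1,\ k\ge 1,\\ \frac{11}{2}\cdot 3^{k}-\frac32 & \text{if } n=3k+2,\ k\ge 1.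 \end{cases} $$ Then for every partial order $P$ on $[n]$, $\mathcal C^{(e)}_P$ has at most $2^n$ facets and $\mathcal O^{(e)}_P$ has at most $b(n)$ facets. Both bounds are tight for every $n\ge1$: $\mathcal C^{(e)}_P$ has exactly $2^n$ facets whenever $P$ is a chain (total order), and $\mathcal O^{(e)}_P$ has exactly $b(n)$ facets whenever $P$ is an ordinal sum of antichains whose sizes, listed from top to bottom, are $(n)$ if $n\le 3$; $(3,\dots,3,2,2,2)$ with $k-2$ threes if $n=3k$, $k\ge2$; $(3,\dots,3,2,2)$ with $k-1$ threes if $n=3k+1$, $k\ge1$; and $(3,\dots,3,2)$ with $k$ threes if $n=3k+2$, $k\ge1$. Such partial orders on $[n]$ exist. -/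

import Mathlib

noncomputable section

namespace EnrichedPoset

/-- The vector `∑_{i ∈ X} ε_i e_i` with signs `ε_i ∈ {-1, 1}` (only the signs of the indices
`i ∈ X` matter). -/
def signedIndicator {ι : Type*} (X : Set ι) (ε : ι → ℤˣ) : ι → ℝ :=
  X.indicator fun i => ((ε i : ℤ) : ℝ)

/-- The set `min(F)` of minimal elements of a subset `F` of the poset `P`. -/
def minSet {ι : Type*} (P : PartialOrder ι) (F : Set ι) : Set ι :=
  {i | @Minimal ι P.toLE (fun j => j ∈ F) i}

/-- The enriched order polytope of a poset: the convex hull of all vectors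
`e_{min(F)}^ε + e_{F \ min(F)}`, where `F` is a filter (an upper set, possibly empty)
and `ε` is a vector of signs. -/
def enrichedOrderPolytope {ι : Type*} (P : PartialOrder ι) : Set (ι → ℝ) :=
  convexHull ℝ {x | ∃ (F : Set ι) (ε : ι → ℤˣ), @IsUpperSet ι P.toLE F ∧
    x = signedIndicator (minSet P F) ε + signedIndicator (F \ minSet P F) 1}

/-- The enriched chain polytope of a poset: the convex hull of all vectors `e_A^ε`, where
`A` is an antichain (possibly empty) and `ε` is a vector of signs. -/
def enrichedChainPolytope {ι : Type*} (P : PartialOrder ι) : Set (ι → ℝ) :=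
  convexHull ℝ {x | ∃ (A : Set ι) (ε : ι → ℤˣ), IsAntichain P.le A ∧ x = signedIndicator A ε}

/-- `G` is a facet of the polytope `Q`: a nonempty face, cut out by a supporting linear
functional, whose dimension is one less than the dimension of `Q`. -/
def IsFacet {ι : Type*} (Q G : Set (ι → ℝ)) : Prop :=
  IsExposed ℝ Q G ∧ G.Nonempty ∧
    Module.finrank ℝ (vectorSpan ℝ G) + 1 = Module.finrank ℝ (vectorSpan ℝ Q)

/-- The set of facets of `Q`. -/
def facets {ι : Type*} (Q : Set (ι → ℝ)) : Set (Set (ι → ℝ)) :=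
  {G | IsFacet Q G}

/-- Any two elements of `P` are comparable. -/
def IsChainPoset {ι : Type*} (P : PartialOrder ι) : Prop :=
  ∀ i j, P.le i j ∨ P.le j i

/-- `P` is the ordinal sum `A_r ⊕ ⋯ ⊕ A_1` of antichains with `|A_1|, …, |A_r|` the given list
of sizes. So `A_1`, the first in the list, is on top, and `i < j` holds exactly when the antichain
containing `i` lies strictly below the one containing `j`. -/
def IsOrdinalSumOfAntichains {ι : Type*} (P : PartialOrder ι) (sizes : List ℕ) : Prop :=
  ∃ level : ι → Fin sizes.length,
    (∀ i j, P.lt i j ↔ level j < level i) ∧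
    ∀ t, {i | level i = t}.ncard = sizes.get t

/-- The upper bound for the number of facets of the enriched order polytope of a poset with
`n ≥ 1` elements; `k = n / 3` is the integer quotient. -/
def orderFacetBound (n : ℕ) : ℚ :=
  if n ≤ 3 then 2 * n
  else if n % 3 = 0 then 47 / 2 * 3 ^ (n / 3 - 2) - 3 / 2
  else if n % 3 = 1 then 23 / 2 * 3 ^ (n / 3 - 1) - 3 / 2
  else 11 / 2 * 3 ^ (n / 3) - 3 / 2

/-- The sizes of the antichains, from top to bottom, in the ordinal sum attaining
`orderFacetBound n`. -/
def extremalSizes (n : ℕ) : List ℕ :=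
  if n ≤ 3 then [n]
  else if n % 3 = 0 then List.replicate (n / 3 - 2) 3 ++ [2, 2, 2]
  else if n % 3 = 1 then List.replicate (n / 3 - 1) 3 ++ [2, 2]
  else List.replicate (n / 3) 3 ++ [2]

end EnrichedPoset

end

open Set Filter Topology MeasureTheory

/-! Both polytopes are first described by inequalities `w ⬝ᵥ x ≤ 1`, and the normals `w` are then
counted.

For a point `x`, let `u i` be the largest value at `x` of a normal attached to a saturated chain
ending at `i`. The inequalities at maximal elements say exactly that `u ≤ 1`. Such a potential
writes `x` as the average over `t ∈ (0, 1]` of vertices: for the order polytope the filter at time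
`t` is `{u ≥ t}`, for the chain polytope the antichain is the set of `i` with `u i - |x i| < t ≤ u
i`. This gives `mem_enrichedOrderPolytope_iff` and `mem_enrichedChainPolytope_iff`.

Every facet lies on one of these hyperplanes (`facets_subset_of_halfspaces`). For the order polytope
each normal does give a facet, because its tight vertices span the space
(`OrderNormal.eq_zero_of_vanish`), so the count is exact: the number `N i` of normals ending at `i`
is 2 if `i` is minimal, and otherwise 1 plus the sum of `N j` over the `j` covered by `i`. For the
chain polytope the upper bound needs only that the corresponding number is at most 2, respectively
twice that sum.

The sum of these weights over the maximal elements is bounded by peeling off the top layer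
(`sum_weight_le`). With `m` elements on top of `n` others this requires `m * (1 + B n) ≤ B (n + m)`,
respectively `m * (2 * 2 ^ n) ≤ 2 ^ (n + m)`. Ordinal sums of antichains satisfy the recursion with
equality at every layer. For a chain, the enriched chain polytope is the cross-polytope. -/

namespace EnrichedPoset

/-! ### Facets of polytopes given by finitely many inequalities -/

section Polytope

variable {ι : Type*} [Fintype ι] [DecidableEq ι]

/-- The part of `Q` on the hyperplane `w ⬝ᵥ x = 1`. -/
def faceAt (Q : Set (ι → ℝ)) (w : ι → ℝ) : Set (ι → ℝ) :=
  {x | x ∈ Q ∧ w ⬝ᵥ x = 1}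

-- Finitely many strict inequalities form an open condition, so a point satisfying them has room in
-- every direction.
omit [DecidableEq ι] in
lemma eventually_dotProduct_lt_one {W : Set (ι → ℝ)} (hW : W.Finite) {z : ι → ℝ}
    (hz : ∀ w ∈ W, w ⬝ᵥ z < 1) (d : ι → ℝ) :
    ∃ t : ℝ, 0 < t ∧ ∀ w ∈ W, w ⬝ᵥ (z + t • d) < 1 := by
  have h : ∀ᶠ t : ℝ in 𝓝[>] 0, ∀ w ∈ W, w ⬝ᵥ (z + t • d) < 1 := by
    rw [eventually_all_finite hW]
    intro w hw
    have hc : Tendsto (fun t : ℝ => w ⬝ᵥ (z + t • d)) (𝓝[>] 0) (𝓝 (w ⬝ᵥ z)) := by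
      have : Continuous (fun t : ℝ => w ⬝ᵥ (z + t • d)) := by
        simp only [dotProduct_add, dotProduct_smul]
        fun_prop
      have h0 := this.tendsto 0
      simp only [zero_smul, add_zero] at h0
      exact h0.mono_left nhdsWithin_le_nhds
    exact hc.eventually_lt_const (hz w hw)
  obtain ⟨t, ht, h0⟩ := (h.and self_mem_nhdsWithin).exists
  exact ⟨t, h0, ht⟩

omit [DecidableEq ι] in
lemma vectorSpan_eq_top_of_halfspaces {W Q : Set (ι → ℝ)} (hW : W.Finite)
    (hQ : ∀ x, x ∈ Q ↔ ∀ w ∈ W, w ⬝ᵥ x ≤ 1) : vectorSpan ℝ Q = ⊤ := by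
  rw [eq_top_iff]
  intro d _
  obtain ⟨t, ht, h⟩ := eventually_dotProduct_lt_one hW (z := 0) (by simp) d
  have h1 : (0 + t • d) ∈ Q := (hQ _).2 fun w hw => (h w hw).le
  have h0 : (0 : ι → ℝ) ∈ Q := (hQ _).2 (by simp)
  have := vsub_mem_vectorSpan ℝ h1 h0
  have h2 := (vectorSpan ℝ Q).smul_mem t⁻¹ this
  simpa [smul_smul, ht.ne'] using h2

lemma ker_dotProduct_finrank {w : ι → ℝ} (hw : w ≠ 0) :
    Module.finrank ℝ (LinearMap.ker (dotProductEquiv ℝ ι w)) + 1 = Fintype.card ι := by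
  have h := Module.Dual.finrank_ker_add_one_of_ne_zero (f := dotProductEquiv ℝ ι w)
    (by simpa using hw)
  simpa using h

lemma vectorSpan_le_ker {G : Set (ι → ℝ)} {w : ι → ℝ} (hG : ∀ x ∈ G, w ⬝ᵥ x = 1) :
    vectorSpan ℝ G ≤ LinearMap.ker (dotProductEquiv ℝ ι w) := by
  rw [vectorSpan, Submodule.span_le]
  rintro _ ⟨x, hx, y, hy, rfl⟩
  simp [hG x hx, hG y hy, dotProduct_sub]

/-- Every facet of a polytope given by finitely many inequalities `w ⬝ᵥ x ≤ 1` lies on one of the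
hyperplanes `w ⬝ᵥ x = 1`. -/
theorem facets_subset_of_halfspaces {W Q : Set (ι → ℝ)} (hW : W.Finite)
    (hQ : ∀ x, x ∈ Q ↔ ∀ w ∈ W, w ⬝ᵥ x ≤ 1) : facets Q ⊆ faceAt Q '' W := by
  rintro G ⟨hexp, hne, hdim⟩
  obtain ⟨l, hl⟩ := hexp hne
  have hGQ : G ⊆ Q := by rw [hl]; exact fun x hx => hx.1
  have hQc : Convex ℝ Q := by
    have : Q = ⋂ w ∈ W, {x | dotProductEquiv ℝ ι w x ≤ 1} := by
      ext x; simp [hQ]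
    rw [this]
    exact convex_iInter₂ fun w _ => convex_halfSpace_le (LinearMap.isLinear _) 1
  have hGc : Convex ℝ G := hexp.convex hQc
  have key : ∃ w ∈ W, ∀ x ∈ G, w ⬝ᵥ x = 1 := by
    by_contra! hcon
    -- If `G` lies on none of the hyperplanes, averaging points that miss them one at a time yields
    -- a point of `G` strictly inside all halfspaces. A functional maximal there is zero, so `G =
    -- Q`, against the dimension.
    have hpt : ∃ z ∈ G, ∀ w ∈ W, w ⬝ᵥ z < 1 := by
      have hS : ∀ S : Set (ι → ℝ), S.Finite → S ⊆ W → ∃ z ∈ G, ∀ w ∈ S, w ⬝ᵥ z < 1 := by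
        intro S hSf
        induction S, hSf using Set.Finite.induction_on with
        | empty =>
          intro _
          obtain ⟨z, hz⟩ := hne
          exact ⟨z, hz, by simp⟩
        | @insert a S _ _ ih =>
          intro hsub
          obtain ⟨z, hz, hzS⟩ := ih ((subset_insert _ _).trans hsub)
          have haW : a ∈ W := hsub (mem_insert _ _)
          obtain ⟨x, hx, hxa⟩ := hcon a haW
          refine ⟨(1 / 2 : ℝ) • z + (1 / 2 : ℝ) • x,
            hGc hz hx (by norm_num) (by norm_num) (by norm_num), ?_⟩
          intro w hw
          have hwW : w ∈ W := hsub hw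
          have h1 : w ⬝ᵥ z ≤ 1 := (hQ z).1 (hGQ hz) w hwW
          have h2 : w ⬝ᵥ x ≤ 1 := (hQ x).1 (hGQ hx) w hwW
          simp only [dotProduct_add, dotProduct_smul, smul_eq_mul]
          rcases hw with rfl | hw
          · have := lt_of_le_of_ne h2 hxa
            linarith
          · have := hzS w hw
            linarith
      exact hS W hW subset_rfl
    obtain ⟨z, hz, hzW⟩ := hpt
    have hzmax : ∀ y ∈ Q, l y ≤ l z := by
      rw [hl] at hz; exact hz.2
    have hl0 : ∀ d, l d ≤ 0 := by
      intro d
      obtain ⟨t, ht, h⟩ := eventually_dotProduct_lt_one hW hzW d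
      have := hzmax _ ((hQ _).2 fun w hw => (h w hw).le)
      simp only [map_add, map_smul, smul_eq_mul] at this
      by_contra! hd
      nlinarith [mul_pos ht hd]
    have hl0' : ∀ d, l d = 0 := fun d => le_antisymm (hl0 d) (by simpa using hl0 (-d))
    have : G = Q := by rw [hl]; ext x; simp [hl0']
    rw [this] at hdim
    omega
  obtain ⟨w, hwW, hw⟩ := key
  refine ⟨w, hwW, ?_⟩
  obtain ⟨x₀, hx₀⟩ := hne
  have hw0 : w ≠ 0 := by
    rintro rfl
    simpa using hw x₀ hx₀
  have hspan : vectorSpan ℝ G = LinearMap.ker (dotProductEquiv ℝ ι w) := by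
    apply Submodule.eq_of_le_of_finrank_eq (vectorSpan_le_ker hw)
    rw [vectorSpan_eq_top_of_halfspaces hW hQ, finrank_top, Module.finrank_fintype_fun_eq_card] at hdim
    have := ker_dotProduct_finrank hw0
    omega
  -- The functional exposing `G` is constant on `G`; as the directions of `G` fill the kernel of
  -- `w`, it is constant on the whole hyperplane slice, which therefore lies in `G`.
  have hlker : vectorSpan ℝ G ≤ LinearMap.ker l.toLinearMap := by
    rw [vectorSpan, Submodule.span_le]
    rintro _ ⟨x, hx, y, hy, rfl⟩
    have h1 := hGQ hx
    have h2 := hGQ hy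
    rw [hl] at hx hy
    have := le_antisymm (hx.2 y h2) (hy.2 x h1)
    simp [this]
  apply Subset.antisymm
  · rintro y ⟨hyQ, hy⟩
    have : y - x₀ ∈ vectorSpan ℝ G := by
      rw [hspan]
      simp [dotProduct_sub, hy, hw x₀ hx₀]
    have h := hlker this
    simp only [LinearMap.mem_ker, ContinuousLinearMap.coe_coe, map_sub, sub_eq_zero] at h
    rw [hl] at hx₀ ⊢
    exact ⟨hyQ, fun z hz => h ▸ hx₀.2 z hz⟩
  · exact fun x hx => ⟨hGQ hx, hw x hx⟩

/-- A valid inequality whose points of equality span the whole space defines a facet. -/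
theorem faceAt_mem_facets [Nonempty ι] {Q : Set (ι → ℝ)} (hQ : vectorSpan ℝ Q = ⊤) {w : ι → ℝ}
    (hw : ∀ x ∈ Q, w ⬝ᵥ x ≤ 1)
    (hspan : ∀ g : ι → ℝ, (∀ x ∈ faceAt Q w, g ⬝ᵥ x = 0) → g = 0) :
    faceAt Q w ∈ facets Q := by
  have hne : (faceAt Q w).Nonempty := by
    by_contra h
    rw [not_nonempty_iff_eq_empty] at h
    have := hspan 1 (by simp [h])
    exact one_ne_zero this
  obtain ⟨x₀, hx₀⟩ := id hne
  have hw0 : w ≠ 0 := by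
    rintro rfl
    simpa using hx₀.2
  refine ⟨fun _ => ⟨LinearMap.toContinuousLinearMap (dotProductEquiv ℝ ι w), ?_⟩, hne, ?_⟩
  · ext x
    simp only [LinearMap.coe_toContinuousLinearMap', dotProductEquiv_apply_apply]
    constructor
    · exact fun hx => ⟨hx.1, fun y hy => hx.2 ▸ hw y hy⟩
    · exact fun hx => ⟨hx.1, le_antisymm (hw x hx.1) (hx₀.2 ▸ hx.2 x₀ hx₀.1)⟩
  · have hle := vectorSpan_le_ker (G := faceAt Q w) (w := w) fun x hx => hx.2
    have heq : vectorSpan ℝ (faceAt Q w) = LinearMap.ker (dotProductEquiv ℝ ι w) := by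
      apply le_antisymm hle
      intro v hv
      by_contra hv'
      obtain ⟨φ, hφv, hφ⟩ := Submodule.exists_le_ker_of_notMem hv'
      obtain ⟨g, rfl⟩ := (dotProductEquiv ℝ ι).surjective φ
      -- Since `g` is constant on the face, subtracting this multiple of `w` makes it vanish there.
      -- Hence `g` is a multiple of `w` and kills `v`.
      have hg : ∀ x ∈ faceAt Q w, (g - (g ⬝ᵥ x₀) • w) ⬝ᵥ x = 0 := by
        intro x hx
        have := hφ (vsub_mem_vectorSpan ℝ hx hx₀)
        simp only [vsub_eq_sub, LinearMap.mem_ker, dotProductEquiv_apply_apply,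
          dotProduct_sub] at this
        simp only [sub_dotProduct, smul_dotProduct, smul_eq_mul, hx.2]
        linarith
      have hgw := sub_eq_zero.1 (hspan _ hg)
      apply hφv
      simp only [LinearMap.mem_ker, dotProductEquiv_apply_apply] at hv ⊢
      rw [hgw, smul_dotProduct, hv, smul_zero]
    rw [heq, hQ, finrank_top, Module.finrank_fintype_fun_eq_card]
    exact ker_dotProduct_finrank hw0

omit [DecidableEq ι] in
lemma faceAt_injOn {Q W : Set (ι → ℝ)}
    (hspan : ∀ w ∈ W, ∀ g : ι → ℝ, (∀ x ∈ faceAt Q w, g ⬝ᵥ x = 0) → g = 0) :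
    InjOn (faceAt Q) W := by
  intro w hw w' _ h
  refine (sub_eq_zero.1 (hspan w hw (w' - w) fun x hx => ?_)).symm
  have hx' : x ∈ faceAt Q w' := h ▸ hx
  rw [sub_dotProduct, hx.2, hx'.2, sub_self]

lemma dotProduct_le_of_mem_convexHull {V : Set (ι → ℝ)} {w : ι → ℝ} {c : ℝ}
    (h : ∀ v ∈ V, w ⬝ᵥ v ≤ c) : ∀ x ∈ convexHull ℝ V, w ⬝ᵥ x ≤ c := by
  have : convexHull ℝ V ⊆ {x | dotProductEquiv ℝ ι w x ≤ c} :=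
    convexHull_min (fun v hv => by simpa using h v hv)
      (convex_halfSpace_le (LinearMap.isLinear _) c)
  exact fun x hx => by simpa using this hx

omit [DecidableEq ι] in
/-- The integral over `(0, 1]` of a curve taking finitely many values. -/
lemma integral_mem_convexHull {V : Set (ι → ℝ)} (hV : V.Finite) {p : ℝ → ι → ℝ}
    (hint : ∀ i, IntegrableOn (fun t => p t i) (Ioc 0 1))
    (hp : ∀ t ∈ Ioc (0 : ℝ) 1, p t ∈ V) :
    (fun i => ∫ t in Ioc (0 : ℝ) 1, p t i) ∈ convexHull ℝ V := by
  have : IsProbabilityMeasure (volume.restrict (Ioc (0 : ℝ) 1)) := ⟨by simp⟩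
  have hint' : IntegrableOn p (Ioc 0 1) := Integrable.of_eval hint
  have h := (convex_convexHull ℝ V).integral_mem (hV.isClosed_convexHull ℝ)
    ((ae_restrict_iff' measurableSet_Ioc).2 (ae_of_all _ fun t ht =>
      subset_convexHull ℝ V (hp t ht))) hint'
  convert h using 1
  ext i
  exact (eval_integral hint i).symm

lemma integrableOn_indicator_Ioc (a b c : ℝ) :
    IntegrableOn ((Ioc a b).indicator fun _ => c) (Ioc (0 : ℝ) 1) :=
  (integrable_const c).indicator measurableSet_Ioc

lemma setIntegral_indicator_Ioc {a b : ℝ} (c : ℝ) (ha : 0 ≤ a) (hab : a ≤ b) (hb : b ≤ 1) :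
    ∫ t in Ioc (0 : ℝ) 1, (Ioc a b).indicator (fun _ => c) t = (b - a) * c := by
  rw [setIntegral_indicator measurableSet_Ioc,
    inter_eq_self_of_subset_right (Ioc_subset_Ioc ha hb)]
  simp [hab]

end Polytope

/-! ### Inequalities of the enriched order polytope -/

section Order

variable {ι : Type*} [P : PartialOrder ι]

/-- The point `e_{min(F)}^ε + e_{F \ min(F)}`. -/
noncomputable def orderVertex (F : Set ι) (ε : ι → ℤˣ) : ι → ℝ :=
  signedIndicator (minSet P F) ε + signedIndicator (F \ minSet P F) 1

lemma mem_minSet {F : Set ι} {i : ι} : i ∈ minSet P F ↔ i ∈ F ∧ ∀ j < i, j ∉ F := by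
  simp only [minSet, mem_ofPred_eq, minimal_iff_forall_lt]

lemma orderVertex_of_notMem {F : Set ι} (ε : ι → ℤˣ) {i : ι} (hi : i ∉ F) :
    orderVertex F ε i = 0 := by
  simp [orderVertex, signedIndicator, mem_minSet, hi]

lemma orderVertex_of_lt {F : Set ι} (hF : IsUpperSet F) (ε : ι → ℤˣ) {i j : ι} (hj : j ∈ F)
    (hji : j < i) : orderVertex F ε i = 1 := by
  have h1 : i ∉ minSet P F := fun h => (mem_minSet.1 h).2 j hji hj
  have h2 : i ∈ F \ minSet P F := ⟨hF hji.le hj, h1⟩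
  simp [orderVertex, signedIndicator, h1, h2]

lemma orderVertex_of_minimal {F : Set ι} (ε : ι → ℤˣ) {i : ι} (hi : i ∈ F)
    (h : ∀ j < i, j ∉ F) : orderVertex F ε i = ((ε i : ℤ) : ℝ) := by
  have h1 : i ∈ minSet P F := mem_minSet.2 ⟨hi, h⟩
  have h2 : i ∉ F \ minSet P F := fun h => h.2 h1
  simp [orderVertex, signedIndicator, h1, h2]

lemma intCast_unit_eq (s : ℤˣ) : ((s : ℤ) : ℝ) = 1 ∨ ((s : ℤ) : ℝ) = -1 := by
  rcases Int.units_eq_one_or s with rfl | rfl <;> simp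

lemma abs_orderVertex_le {F : Set ι} (hF : IsUpperSet F) (ε : ι → ℤˣ) (i : ι) :
    |orderVertex F ε i| ≤ F.indicator 1 i := by
  by_cases hi : i ∈ F
  · rw [indicator_of_mem hi]
    by_cases h : ∀ j < i, j ∉ F
    · rw [orderVertex_of_minimal ε hi h]
      rcases intCast_unit_eq (ε i) with h | h <;> simp [h]
    · push Not at h
      obtain ⟨j, hj, hjF⟩ := h
      simp [orderVertex_of_lt hF ε hjF hj]
  · simp [orderVertex_of_notMem ε hi, hi]

lemma orderVertex_mem {F : Set ι} (hF : IsUpperSet F) (ε : ι → ℤˣ) :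
    orderVertex F ε ∈ enrichedOrderPolytope P :=
  subset_convexHull _ _ ⟨F, ε, hF, rfl⟩

variable [DecidableEq ι]

/-- The normals `±2 ^ (r - 1) e_{i_r} - 2 ^ (r - 2) e_{i_{r-1}} - ⋯ - e_{i_1}` of the enriched order
polytope, for saturated chains `i_r ⋖ ⋯ ⋖ i_1 = i`; the negative sign is allowed if `i_r` is
minimal. -/
inductive OrderNormal : ι → (ι → ℝ) → Prop
  | pos (i : ι) : OrderNormal i (Pi.single i 1)
  | neg (i : ι) : IsMin i → OrderNormal i (-Pi.single i 1)
  | step (i j : ι) (f : ι → ℝ) : j ⋖ i → OrderNormal j f →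
      OrderNormal i ((2 : ℝ) • f - Pi.single i 1)

lemma OrderNormal.eq_zero {i : ι} {f : ι → ℝ} (h : OrderNormal i f) {k : ι} (hk : ¬ k ≤ i) :
    f k = 0 := by
  induction h with
  | pos i => exact Pi.single_eq_of_ne (fun h => hk h.le) _
  | neg i _ => simp [Pi.single_eq_of_ne (fun h => hk h.le : k ≠ i)]
  | step i j f hji _ ih =>
    simp [Pi.single_eq_of_ne (fun h => hk h.le : k ≠ i), ih fun h => hk (h.trans hji.le)]

lemma OrderNormal.apply_self {i : ι} {f : ι → ℝ} (h : OrderNormal i f) :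
    f i = 1 ∨ f i = -1 := by
  cases h with
  | pos => simp
  | neg => simp
  | step _ j f hji hf => simp [hf.eq_zero hji.lt.not_ge]

/-- Each step doubles the earlier coefficients. The endpoint is thus the only odd coordinate, so a
normal determines its endpoint and the counts below are over disjoint sets. -/
lemma OrderNormal.apply_even {i : ι} {f : ι → ℝ} (h : OrderNormal i f) {k : ι} (hk : k ≠ i) :
    ∃ z : ℤ, f k = 2 * z := by
  have key : ∀ {i : ι} {f : ι → ℝ}, OrderNormal i f → ∀ k, ∃ z : ℤ, f k = z := by
    intro i f h
    induction h with
    | pos i => exact fun k => ⟨(Pi.single i 1 : ι → ℤ) k, by simp [Pi.single_apply]⟩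
    | neg i _ => exact fun k => ⟨-(Pi.single i 1 : ι → ℤ) k, by simp [Pi.single_apply]⟩
    | step i j f _ _ ih =>
      intro k
      obtain ⟨z, hz⟩ := ih k
      exact ⟨2 * z - (Pi.single i 1 : ι → ℤ) k, by simp [Pi.single_apply, hz]⟩
  cases h with
  | pos => exact ⟨0, by simp [hk]⟩
  | neg => exact ⟨0, by simp [hk]⟩
  | step _ j f hji hf =>
    obtain ⟨z, hz⟩ := key hf k
    exact ⟨z, by simp [hk, hz]⟩

lemma OrderNormal.index_unique {i j : ι} {f : ι → ℝ} (hi : OrderNormal i f)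
    (hj : OrderNormal j f) : i = j := by
  by_contra hne
  obtain ⟨z, hz⟩ := hj.apply_even hne
  have : (2 * z = 1) ∨ (2 * z = -1) := by
    rcases hi.apply_self with h | h <;> rw [hz] at h
    · left; exact_mod_cast h
    · right; exact_mod_cast h
  omega

lemma setOf_orderNormal_of_isMin {i : ι} (hi : IsMin i) :
    {f | OrderNormal i f} = {Pi.single i 1, -Pi.single i 1} := by
  ext f
  constructor
  · rintro (_ | _ | ⟨_, j, f, hji, -⟩)
    · simp
    · simp
    · exact (hi.not_lt hji.lt).elim
  · rintro (rfl | rfl)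
    · exact .pos i
    · exact .neg i hi

lemma setOf_orderNormal_of_not_isMin {i : ι} (hi : ¬ IsMin i) :
    {f | OrderNormal i f} = insert (Pi.single i 1)
      (⋃ j ∈ {j | j ⋖ i}, (fun f => (2 : ℝ) • f - Pi.single i 1) '' {f | OrderNormal j f}) := by
  ext f
  simp only [mem_ofPred_eq, mem_insert_iff, mem_iUnion, mem_image, exists_prop]
  constructor
  · rintro (_ | ⟨_, h⟩ | ⟨_, j, f, hji, hf⟩)
    · simp
    · exact (hi h).elim
    · exact Or.inr ⟨j, hji, f, hf, rfl⟩
  · rintro (rfl | ⟨j, hji, f, hf, rfl⟩)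
    · exact .pos i
    · exact .step i j f hji hf

lemma finite_setOf_orderNormal [Finite ι] (i : ι) : {f | OrderNormal i f}.Finite := by
  induction i using WellFoundedLT.induction with
  | _ i ih =>
    by_cases hi : IsMin i
    · rw [setOf_orderNormal_of_isMin hi]
      exact toFinite _
    · rw [setOf_orderNormal_of_not_isMin hi]
      refine .insert _ ((toFinite _).biUnion fun j hj => (ih j ?_).image _)
      exact CovBy.lt hj

variable [Fintype ι]

/-- The indicator on the right, sharper than 1, carries the induction: if `j ∈ F` then coordinate
`i` is 1 and the value is at most `2 - 1`; if `j ∉ F` the doubled term is nonpositive. -/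
lemma OrderNormal.dotProduct_orderVertex_le {i : ι} {f : ι → ℝ} (h : OrderNormal i f)
    {F : Set ι} (hF : IsUpperSet F) (ε : ι → ℤˣ) :
    f ⬝ᵥ orderVertex F ε ≤ F.indicator 1 i := by
  induction h with
  | pos i =>
    simpa using (le_abs_self _).trans (abs_orderVertex_le hF ε i)
  | neg i _ =>
    simpa using (neg_le_abs _).trans (abs_orderVertex_le hF ε i)
  | step i j f hji _ ih =>
    have h1 := (neg_le_abs _).trans (abs_orderVertex_le hF ε i)
    simp only [sub_dotProduct, smul_dotProduct, smul_eq_mul, single_one_dotProduct]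
    by_cases hj : j ∈ F
    · rw [orderVertex_of_lt hF ε hj hji.lt, indicator_of_mem (hF hji.le hj)]
      rw [indicator_of_mem hj] at ih
      simp only [Pi.one_apply] at ih ⊢
      linarith
    · rw [indicator_of_notMem hj] at ih
      linarith

/-- The maximal size of a value `f ⬝ᵥ x` with `f` a normal ending at `i` gives the filters of a
decomposition of `x`. -/
lemma exists_potential {x : ι → ℝ}
    (hx : ∀ i, IsMax i → ∀ f, OrderNormal i f → f ⬝ᵥ x ≤ 1) :
    ∃ u : ι → ℝ, (∀ i, |x i| ≤ u i) ∧ (∀ i, u i ≤ 1) ∧ (∀ i j, i ≤ j → u i ≤ u j) ∧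
      ∀ i j, j < i → 2 * u j - x i ≤ u i := by
  have hmax : ∀ i, ∃ f, OrderNormal i f ∧ ∀ g, OrderNormal i g → g ⬝ᵥ x ≤ f ⬝ᵥ x := fun i =>
    exists_max_image {f | OrderNormal i f} (· ⬝ᵥ x) (finite_setOf_orderNormal i) ⟨_, .pos i⟩
  choose f hf hfmax using hmax
  have hpos : ∀ i, x i ≤ f i ⬝ᵥ x := fun i => by simpa using hfmax i _ (.pos i)
  have hcov : ∀ i j, j ⋖ i → 2 * (f j ⬝ᵥ x) - x i ≤ f i ⬝ᵥ x := fun i j hji => by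
    simpa using hfmax i _ (.step i j _ hji (hf j))
  have habs : ∀ i, |x i| ≤ f i ⬝ᵥ x := by
    intro i
    induction i using WellFoundedLT.induction with
    | _ i ih =>
      refine abs_le'.2 ⟨hpos i, ?_⟩
      by_cases hi : IsMin i
      · simpa using hfmax i _ (.neg i hi)
      · obtain ⟨k, hk⟩ := not_isMin_iff.1 hi
        obtain ⟨j, -, hj⟩ := exists_le_covBy_of_lt hk
        have := (abs_nonneg _).trans (ih j hj.lt)
        linarith [hcov i j hj]
  -- Along a cover `k ⋖ j`, add `2 * u k - x j ≤ u j` and `x j ≤ u j`.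
  have hmono : ∀ i j, i ≤ j → f i ⬝ᵥ x ≤ f j ⬝ᵥ x := by
    intro i j
    induction j using WellFoundedLT.induction with
    | _ j ih =>
      intro hij
      rcases hij.eq_or_lt with rfl | hlt
      · rfl
      · obtain ⟨k, hik, hkj⟩ := exists_le_covBy_of_lt hlt
        linarith [ih k hkj.lt hik, hcov j k hkj, hpos j]
  refine ⟨fun i => f i ⬝ᵥ x, habs, fun i => ?_, hmono, fun i j hji => ?_⟩
  · obtain ⟨m, him, hm⟩ := Finite.exists_le_maximal (p := fun _ : ι => True) (a := i) trivial
    exact (hmono i m him).trans (hx m (maximal_true.1 hm) _ (hf m))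
  · obtain ⟨k, hjk, hki⟩ := exists_le_covBy_of_lt hji
    linarith [hcov i k hki, hmono j k hjk]

omit [DecidableEq ι] in
lemma mem_enrichedOrderPolytope_of_potential {x u : ι → ℝ} (habs : ∀ i, |x i| ≤ u i)
    (hle : ∀ i, u i ≤ 1) (hmono : ∀ i j, i ≤ j → u i ≤ u j)
    (hlt : ∀ i j, j < i → 2 * u j - x i ≤ u i) : x ∈ enrichedOrderPolytope P := by
  classical
  have h1 : ∀ i, 0 ≤ (x i + u i) / 2 := fun i => by linarith [(neg_le_abs _).trans (habs i)]
  have h2 : ∀ i, (x i + u i) / 2 ≤ u i := fun i => by linarith [(le_abs_self _).trans (habs i)]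
  -- Coordinate `i` is 1 for time `(x i + u i) / 2`, then -1 until `u i`, so its integral is `x i`.
  let p : ℝ → ι → ℝ := fun t i =>
    (Ioc 0 ((x i + u i) / 2)).indicator (fun _ => 1) t +
      (Ioc ((x i + u i) / 2) (u i)).indicator (fun _ => -1) t
  have hp : ∀ t ∈ Ioc (0 : ℝ) 1, p t ∈ {x | ∃ (F : Set ι) (ε : ι → ℤˣ), IsUpperSet F ∧
      x = signedIndicator (minSet P F) ε + signedIndicator (F \ minSet P F) 1} := by
    intro t ht
    have hF : IsUpperSet {i | t ≤ u i} := fun i j hij hi => le_trans hi (hmono i j hij)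
    refine ⟨{i | t ≤ u i}, fun i => if t ≤ (x i + u i) / 2 then 1 else -1, hF, ?_⟩
    change p t = orderVertex _ _
    ext i
    by_cases hi : t ≤ u i
    · have hiF : i ∈ {i | t ≤ u i} := hi
      by_cases hmin : ∀ j < i, j ∉ {i | t ≤ u i}
      · rw [orderVertex_of_minimal _ hiF hmin]
        by_cases hti : t ≤ (x i + u i) / 2
        · simp [p, indicator, ht.1, hti, hti.not_gt]
        · simp [p, indicator, hti, hi, not_le.1 hti]
      · push Not at hmin
        obtain ⟨j, hji, hj⟩ := hmin
        rw [orderVertex_of_lt hF _ hj hji]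
        -- A nonminimal element of the filter must still be in its positive phase; this is what
        -- `hlt` provides.
        have hti : t ≤ (x i + u i) / 2 := by
          have := hlt i j hji
          simp only [mem_ofPred_eq] at hj
          linarith
        simp [p, indicator, ht.1, hti, hti.not_gt]
    · have hiF : i ∉ {i | t ≤ u i} := hi
      rw [orderVertex_of_notMem _ hiF]
      have hti : ¬ t ≤ (x i + u i) / 2 := fun h => hi (h.trans (h2 i))
      simp [p, indicator, hti, hi]
  have hfin : {x | ∃ (F : Set ι) (ε : ι → ℤˣ), IsUpperSet F ∧
      x = signedIndicator (minSet P F) ε + signedIndicator (F \ minSet P F) 1}.Finite := by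
    refine (finite_range fun q : Set ι × (ι → ℤˣ) => orderVertex q.1 q.2).subset ?_
    rintro _ ⟨F, ε, -, rfl⟩
    exact ⟨(F, ε), rfl⟩
  have hint := integral_mem_convexHull hfin (p := p)
    (fun i => (integrableOn_indicator_Ioc _ _ _).add (integrableOn_indicator_Ioc _ _ _)) hp
  have hx : x = fun i => ∫ t in Ioc (0 : ℝ) 1, p t i := by
    ext i
    simp only [p]
    rw [integral_add (integrableOn_indicator_Ioc _ _ _) (integrableOn_indicator_Ioc _ _ _),
      setIntegral_indicator_Ioc _ le_rfl (h1 i) ((h2 i).trans (hle i)),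
      setIntegral_indicator_Ioc _ (h1 i) (h2 i) (hle i)]
    ring
  rw [hx]
  exact hint

variable (ι) in
/-- The facet normals of the enriched order polytope. -/
def orderNormals : Set (ι → ℝ) := {f | ∃ i, IsMax i ∧ OrderNormal i f}

lemma finite_orderNormals : (orderNormals ι).Finite := by
  have : orderNormals ι ⊆ ⋃ i, {f | OrderNormal i f} := by
    rintro f ⟨i, -, hf⟩
    exact mem_iUnion.2 ⟨i, hf⟩
  exact (finite_iUnion finite_setOf_orderNormal).subset this

theorem mem_enrichedOrderPolytope_iff {x : ι → ℝ} :
    x ∈ enrichedOrderPolytope P ↔ ∀ f ∈ orderNormals ι, f ⬝ᵥ x ≤ 1 := by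
  constructor
  · rintro hx f ⟨i, -, hf⟩
    refine dotProduct_le_of_mem_convexHull ?_ x hx
    rintro _ ⟨F, ε, hF, rfl⟩
    refine (hf.dotProduct_orderVertex_le hF ε).trans ?_
    exact indicator_le_self' (by simp) i
  · intro h
    obtain ⟨u, h1, h2, h3, h4⟩ := exists_potential fun i hi f hf => h f ⟨i, hi, hf⟩
    exact mem_enrichedOrderPolytope_of_potential h1 h2 h3 h4

end Order

/-! ### Every order normal defines a facet -/

section OrderFacets

variable {ι : Type*} [P : PartialOrder ι] [DecidableEq ι] [Fintype ι]

omit [Fintype ι] in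
lemma orderVertex_update_sub {F : Set ι} (hF : IsUpperSet F) (ε : ι → ℤˣ) {k : ι} (hk : k ∈ F)
    (hmin : ∀ j < k, j ∉ F) :
    orderVertex F (Function.update ε k 1) - orderVertex F (Function.update ε k (-1)) =
      Pi.single k 2 := by
  ext i
  by_cases hik : i = k
  · subst hik
    simp [orderVertex_of_minimal _ hk hmin]
    norm_num
  · rw [Pi.single_eq_of_ne hik, Pi.sub_apply, sub_eq_zero]
    by_cases hi : i ∈ F
    · by_cases h : ∀ j < i, j ∉ F
      · simp [orderVertex_of_minimal _ hi h, hik]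
      · push Not at h
        obtain ⟨j, hj, hjF⟩ := h
        simp [orderVertex_of_lt hF _ hjF hj]
    · simp [orderVertex_of_notMem _ hi]

open Classical in
lemma dotProduct_orderVertex_Ici (g : ι → ℝ) (i : ι) (s : ℤˣ) :
    g ⬝ᵥ orderVertex (Ici i) (fun _ => s) =
      g i * ((s : ℤ) : ℝ) + ∑ k ∈ Finset.univ.filter (i < ·), g k := by
  have h : orderVertex (Ici i) (fun _ => s) =
      Pi.single i ((s : ℤ) : ℝ) + fun k => if i < k then 1 else 0 := by
    ext k
    rcases eq_or_ne k i with rfl | hne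
    · rw [orderVertex_of_minimal _ self_mem_Ici fun j hj => by simpa using hj.not_ge]
      simp
    · by_cases hk : i < k
      · rw [orderVertex_of_lt (isUpperSet_Ici i) _ self_mem_Ici hk]
        simp [hne, hk]
      · rw [orderVertex_of_notMem]
        · simp [hne, hk]
        · exact fun h => hk (lt_of_le_of_ne h hne.symm)
  rw [h, dotProduct_add, dotProduct_single]
  simp [dotProduct, Finset.sum_filter]

lemma OrderNormal.dotProduct_eq_zero {j : ι} {f : ι → ℝ} (h : OrderNormal j f) {F : Set ι}
    (hF : IsUpperSet F) (hj : j ∉ F) (ε : ι → ℤˣ) : f ⬝ᵥ orderVertex F ε = 0 := by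
  refine Finset.sum_eq_zero fun k _ => ?_
  by_cases hk : k ≤ j
  · rw [orderVertex_of_notMem _ fun h => hj (hF hk h), mul_zero]
  · rw [h.eq_zero hk, zero_mul]

/-- Two tight vertices differing only in the sign at `k` differ by `2 e_k`. -/
lemma eq_zero_of_two_signs {f g : ι → ℝ}
    (hg : ∀ (F : Set ι) ε, IsUpperSet F → f ⬝ᵥ orderVertex F ε = 1 → g ⬝ᵥ orderVertex F ε = 0)
    {F : Set ι} (hF : IsUpperSet F) (ε : ι → ℤˣ) {k : ι} (hk : k ∈ F)
    (hmin : ∀ j < k, j ∉ F)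
    (htight : ∀ s, f ⬝ᵥ orderVertex F (Function.update ε k s) = 1) : g k = 0 := by
  have h1 := hg F _ hF (htight 1)
  have h2 := hg F _ hF (htight (-1))
  have h3 : g ⬝ᵥ Pi.single k 2 = 0 := by
    rw [← orderVertex_update_sub hF ε hk hmin, dotProduct_sub, h1, h2, sub_zero]
  simpa using h3

open Classical in
/-- A functional vanishing on the vertices on the hyperplane of a normal `f` ending at `i` vanishes
at all coordinates not above `i`, provided that it kills the vector `e_{k : k > i}`. -/
lemma OrderNormal.eq_zero_of_vanish {i : ι} {f g : ι → ℝ} (h : OrderNormal i f)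
    (hg : ∀ (F : Set ι) ε, IsUpperSet F → f ⬝ᵥ orderVertex F ε = 1 → g ⬝ᵥ orderVertex F ε = 0)
    (hsum : ∑ k ∈ Finset.univ.filter (i < ·), g k = 0) : ∀ k, ¬ i < k → g k = 0 := by
  have hF : ∀ i k : ι, IsUpperSet (Ici i ∪ Ici k) := fun i k =>
    (isUpperSet_Ici i).union (isUpperSet_Ici k)
  have hmin : ∀ {i k : ι}, ¬ i ≤ k → ∀ l < k, l ∉ Ici i ∪ Ici k := by
    rintro i k hik l hl (h | h)
    · exact hik (le_trans h hl.le)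
    · exact not_le_of_gt hl h
  have hself : ∀ {i : ι} (s : ℤˣ),
      orderVertex (Ici i) (fun _ => s) i = ((s : ℤ) : ℝ) := fun s =>
    orderVertex_of_minimal _ self_mem_Ici fun j hj => by simpa using hj.not_ge
  induction h with
  | pos i =>
    intro k hk
    rcases eq_or_ne k i with rfl | hne
    · have := hg (Ici k) (fun _ => 1) (isUpperSet_Ici k) (by simp [hself])
      rw [dotProduct_orderVertex_Ici, hsum] at this
      simpa using this
    · have hik : ¬ i ≤ k := fun h => hk (lt_of_le_of_ne h hne.symm)
      refine eq_zero_of_two_signs hg (hF i k) 1 (mem_union_right _ self_mem_Ici) (hmin hik) fun s => ?_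
      rw [single_one_dotProduct]
      by_cases hi : ∀ l < i, l ∉ Ici i ∪ Ici k
      · rw [orderVertex_of_minimal _ (mem_union_left _ self_mem_Ici) hi]
        simp [hne.symm]
      · push Not at hi
        obtain ⟨l, hl, hlF⟩ := hi
        exact orderVertex_of_lt (hF i k) _ hlF hl
  | neg i hi =>
    intro k hk
    rcases eq_or_ne k i with rfl | hne
    · have := hg (Ici k) (fun _ => -1) (isUpperSet_Ici k) (by simp [hself])
      rw [dotProduct_orderVertex_Ici, hsum] at this
      simpa using this
    · have hik : ¬ i ≤ k := fun h => hk (lt_of_le_of_ne h hne.symm)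
      refine eq_zero_of_two_signs hg (hF i k) (fun _ => -1) (mem_union_right _ self_mem_Ici) (hmin hik)
        fun s => ?_
      rw [neg_dotProduct, single_one_dotProduct,
        orderVertex_of_minimal _ (mem_union_left _ self_mem_Ici) fun l hl => (hi.not_lt hl).elim]
      simp [hne.symm]
  | step i j f hji hf ih =>
    -- The filter above `i` omits `j`, so only the term `-e_i` sees it, and the sign -1 makes the
    -- vertex tight.
    have hgi : g i = 0 := by
      have := hg (Ici i) (fun _ => -1) (isUpperSet_Ici i) (by
        rw [sub_dotProduct, smul_dotProduct,
          hf.dotProduct_eq_zero (isUpperSet_Ici i) (by simpa using hji.lt.not_ge)]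
        simp [hself])
      rw [dotProduct_orderVertex_Ici, hsum] at this
      simpa using this
    have hgk : ∀ k, j < k → ¬ i ≤ k → g k = 0 := by
      intro k hjk hik
      have hne : k ≠ i := fun h => hik h.ge
      -- As `i` covers `j`, no `k` lies strictly between. Hence `i` and `k` are both minimal in the
      -- filter they generate, and the sign at `k` is free.
      have hki : ¬ k ≤ i := fun h => hji.2 hjk (lt_of_le_of_ne h hne)
      refine eq_zero_of_two_signs hg (hF i k) (fun _ => -1) (mem_union_right _ self_mem_Ici) (hmin hik)
        fun s => ?_
      have hj : j ∉ Ici i ∪ Ici k := by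
        simp [hji.lt.not_ge, hjk.not_ge]
      have hi : ∀ l < i, l ∉ Ici i ∪ Ici k := by
        rw [union_comm]
        exact hmin hki
      rw [sub_dotProduct, smul_dotProduct, hf.dotProduct_eq_zero (hF i k) hj,
        single_one_dotProduct, orderVertex_of_minimal _ (mem_union_left _ self_mem_Ici) hi]
      simp [hne.symm]
    have hgj : ∀ k, j < k → ¬ i < k → g k = 0 := by
      intro k hjk hik
      rcases eq_or_ne k i with rfl | hne
      · exact hgi
      · exact hgk k hjk fun h => hik (lt_of_le_of_ne h hne.symm)
    -- A vertex tight for `f` has `j ∈ F`, hence coordinate 1 at `i`, and is tight for `2 f - e_i`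
    -- too. The sums of `g` above `j` and above `i` agree by `hgj`.
    have hrec : ∀ k, ¬ j < k → g k = 0 := by
      refine ih (fun F ε hFu htight => hg F ε hFu ?_) ?_
      · have hjF : j ∈ F := by
          by_contra hjF
          rw [hf.dotProduct_eq_zero hFu hjF] at htight
          norm_num at htight
        rw [sub_dotProduct, smul_dotProduct, htight, single_one_dotProduct,
          orderVertex_of_lt hFu ε hjF hji.lt]
        norm_num
      · rw [← hsum]
        refine (Finset.sum_subset ?_ ?_).symm
        · intro k hk
          simp only [Finset.mem_filter, Finset.mem_univ, true_and] at hk ⊢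
          exact hji.lt.trans hk
        · intro k hk hk'
          simp only [Finset.mem_filter, Finset.mem_univ, true_and] at hk hk'
          exact hgj k hk hk'
    intro k hk
    by_cases hjk : j < k
    · exact hgj k hjk hk
    · exact hrec k hjk

lemma eq_zero_of_vanish_on_orderFace {w : ι → ℝ} (hw : w ∈ orderNormals ι) {g : ι → ℝ}
    (hg : ∀ x ∈ faceAt (enrichedOrderPolytope P) w, g ⬝ᵥ x = 0) : g = 0 := by
  obtain ⟨i, hi, hf⟩ := hw
  ext k
  refine hf.eq_zero_of_vanish (fun F ε hF h => hg _ ⟨orderVertex_mem hF ε, h⟩) ?_ k hi.not_lt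
  simp [hi.not_lt]

variable (ι) in
/-- The facets of the enriched order polytope are the faces given by `orderNormals`. -/
theorem facets_enrichedOrderPolytope [Nonempty ι] :
    facets (enrichedOrderPolytope P) = faceAt (enrichedOrderPolytope P) '' orderNormals ι := by
  refine (facets_subset_of_halfspaces finite_orderNormals
    fun _ => mem_enrichedOrderPolytope_iff).antisymm ?_
  rintro _ ⟨w, hw, rfl⟩
  exact faceAt_mem_facets
    (vectorSpan_eq_top_of_halfspaces finite_orderNormals fun _ => mem_enrichedOrderPolytope_iff)
    (fun x hx => mem_enrichedOrderPolytope_iff.1 hx w hw)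
    fun _ hg => eq_zero_of_vanish_on_orderFace hw hg

variable (ι) in
theorem ncard_facets_enrichedOrderPolytope [Nonempty ι] :
    (facets (enrichedOrderPolytope P)).ncard = (orderNormals ι).ncard := by
  rw [facets_enrichedOrderPolytope]
  exact (faceAt_injOn fun w hw g hg => eq_zero_of_vanish_on_orderFace hw hg).ncard_image

end OrderFacets

/-! ### Recursive count of the order normals -/

section OrderCount

variable {ι : Type*} [P : PartialOrder ι] [DecidableEq ι] [Fintype ι]

omit [Fintype ι] in
lemma ncard_orderNormal_of_isMin {i : ι} (hi : IsMin i) : {f | OrderNormal i f}.ncard = 2 := by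
  rw [setOf_orderNormal_of_isMin hi, ncard_pair]
  intro h
  have := congrFun h i
  norm_num at this

omit P [Fintype ι] in
lemma ncard_biUnion_finset {α : Type*} (s : Finset ι) {D : ι → Set α}
    (hfin : ∀ i ∈ s, (D i).Finite) (hdisj : (s : Set ι).PairwiseDisjoint D) :
    (⋃ i ∈ s, D i).ncard = ∑ i ∈ s, (D i).ncard := by
  induction s using Finset.induction_on with
  | empty => simp
  | insert a s ha ih =>
    have hs : (⋃ i ∈ s, D i).Finite := by
      simpa using s.finite_toSet.biUnion fun i hi => hfin i (by simp_all)
    rw [Finset.set_biUnion_insert, ncard_union_eq _ (hfin a (by simp)) hs, Finset.sum_insert ha,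
      ih (fun i hi => hfin i (by simp [hi])) (hdisj.subset (by simp))]
    rw [disjoint_iUnion₂_right]
    intro i hi
    exact hdisj (by simp) (by simp [hi]) (by rintro rfl; exact ha hi)

open Classical in
lemma ncard_orderNormal_of_not_isMin {i : ι} (hi : ¬ IsMin i) : {f | OrderNormal i f}.ncard =
    1 + ∑ j ∈ Finset.univ.filter (· ⋖ i), {f | OrderNormal j f}.ncard := by
  have hinj : Function.Injective fun f : ι → ℝ => (2 : ℝ) • f - Pi.single i 1 := by
    intro f g h
    simpa using h
  have hfin : ∀ j, ((fun f : ι → ℝ => (2 : ℝ) • f - Pi.single i 1) ''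
      {f | OrderNormal j f}).Finite := fun j => (finite_setOf_orderNormal j).image _
  have hset : {j | j ⋖ i} = ((Finset.univ.filter (· ⋖ i) : Finset ι) : Set ι) := by ext; simp
  rw [setOf_orderNormal_of_not_isMin hi, hset, ncard_insert_of_notMem _
    ((Finset.finite_toSet _).biUnion fun j _ => hfin j), add_comm]
  · congr 1
    simp only [Finset.mem_coe]
    rw [ncard_biUnion_finset]
    · exact Finset.sum_congr rfl fun j _ => ncard_image_of_injective _ hinj
    · exact fun j _ => hfin j
    · intro j _ k _ hjk
      rw [Function.onFun, disjoint_image_iff hinj, Set.disjoint_left]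
      exact fun f hj hk => hjk (OrderNormal.index_unique hj hk)
  -- The normal `e_i` is not produced by a step, since a step gives coordinate -1 at `i`.
  · simp only [mem_iUnion, mem_image, not_exists, not_and]
    intro j hj f hf h
    have hji : j ⋖ i := by simpa using hj
    have := congrFun h i
    simp [OrderNormal.eq_zero hf hji.lt.not_ge] at this
    norm_num at this

variable (ι) in
open Classical in
lemma ncard_orderNormals : (orderNormals ι).ncard =
    ∑ i ∈ Finset.univ.filter (IsMax : ι → Prop), {f | OrderNormal i f}.ncard := by
  have : orderNormals ι =
      ⋃ i ∈ Finset.univ.filter (IsMax : ι → Prop), {f | OrderNormal i f} := by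
    ext f
    simp [orderNormals]
  rw [this, ncard_biUnion_finset _ fun i _ => finite_setOf_orderNormal i]
  intro j _ k _ hjk
  rw [Function.onFun, Set.disjoint_left]
  exact fun f hj hk => hjk (OrderNormal.index_unique hj hk)

end OrderCount

/-! ### Inequalities and facets of the enriched chain polytope -/

section Chain

variable {ι : Type*} [P : PartialOrder ι] [DecidableEq ι]

/-- The normals `∑_{k ∈ C} s_k e_k` of the enriched chain polytope, for saturated chains `C` from a
minimal element to `i`. -/
inductive ChainNormal : ι → (ι → ℝ) → Prop
  | min (i : ι) (s : ℤˣ) : IsMin i → ChainNormal i (Pi.single i ((s : ℤ) : ℝ))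
  | step (i j : ι) (f : ι → ℝ) (s : ℤˣ) : j ⋖ i → ChainNormal j f →
      ChainNormal i (f + Pi.single i ((s : ℤ) : ℝ))

lemma ChainNormal.eq_zero {i : ι} {f : ι → ℝ} (h : ChainNormal i f) {k : ι} (hk : ¬ k ≤ i) :
    f k = 0 := by
  induction h with
  | min i s _ => exact Pi.single_eq_of_ne (fun h => hk h.le) _
  | step i j f s hji _ ih =>
    simp [Pi.single_eq_of_ne (fun h => hk h.le : k ≠ i), ih fun h => hk (h.trans hji.le)]

lemma setOf_chainNormal_of_isMin {i : ι} (hi : IsMin i) :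
    {f | ChainNormal i f} ⊆ {Pi.single i 1, Pi.single i (-1)} := by
  rintro f (⟨_, s, _⟩ | ⟨_, j, f, s, hji, -⟩)
  · rcases Int.units_eq_one_or s with rfl | rfl <;> simp
  · exact (hi.not_lt hji.lt).elim

open Classical in
lemma setOf_chainNormal_of_not_isMin [Fintype ι] {i : ι} (hi : ¬ IsMin i) :
    {f | ChainNormal i f} ⊆
      (fun f => f + Pi.single i 1) '' (⋃ j ∈ Finset.univ.filter (· ⋖ i), {f | ChainNormal j f}) ∪
      (fun f => f + Pi.single i (-1)) ''
        (⋃ j ∈ Finset.univ.filter (· ⋖ i), {f | ChainNormal j f}) := by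
  rintro f (⟨_, s, h⟩ | ⟨_, j, f, s, hji, hf⟩)
  · exact (hi h).elim
  · have hfU : f ∈ ⋃ j ∈ Finset.univ.filter (· ⋖ i), {f | ChainNormal j f} := by
      simp only [Finset.mem_filter, Finset.mem_univ, true_and, mem_iUnion, mem_ofPred_eq,
        exists_prop]
      exact ⟨j, hji, hf⟩
    rcases Int.units_eq_one_or s with rfl | rfl
    · exact Or.inl ⟨f, hfU, by simp⟩
    · exact Or.inr ⟨f, hfU, by simp⟩

variable [Fintype ι]

lemma finite_setOf_chainNormal (i : ι) : {f | ChainNormal i f}.Finite := by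
  classical
  induction i using WellFoundedLT.induction with
  | _ i ih =>
    by_cases hi : IsMin i
    · exact (toFinite _).subset (setOf_chainNormal_of_isMin hi)
    · have h : (⋃ j ∈ Finset.univ.filter (· ⋖ i), {f | ChainNormal j f}).Finite := by
        have := (Finset.univ.filter (· ⋖ i)).finite_toSet.biUnion (t := fun j =>
          {f | ChainNormal j f}) fun j hj => ih j (by
            simp only [Finset.coe_filter, Finset.mem_univ, true_and, mem_ofPred_eq] at hj
            exact hj.lt)
        simpa using this
      exact ((h.image _).union (h.image _)).subset (setOf_chainNormal_of_not_isMin hi)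

omit [Fintype ι] in
lemma ncard_chainNormal_of_isMin {i : ι} (hi : IsMin i) : {f | ChainNormal i f}.ncard ≤ 2 :=
  (ncard_le_ncard (setOf_chainNormal_of_isMin hi)).trans ((ncard_insert_le _ _).trans (by simp))

open Classical in
lemma ncard_chainNormal_of_not_isMin {i : ι} (hi : ¬ IsMin i) : {f | ChainNormal i f}.ncard ≤
    2 * ∑ j ∈ Finset.univ.filter (· ⋖ i), {f | ChainNormal j f}.ncard := by
  have h : (⋃ j ∈ Finset.univ.filter (· ⋖ i), {f | ChainNormal j f}).Finite :=
    (finite_iUnion finite_setOf_chainNormal).subset (iUnion_mono fun j => by simp)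
  have h2 := Finset.set_ncard_biUnion_le (Finset.univ.filter (· ⋖ i)) fun j => {f | ChainNormal j f}
  have h3 := ncard_le_ncard (setOf_chainNormal_of_not_isMin hi) ((h.image _).union (h.image _))
  refine h3.trans ((ncard_union_le _ _).trans ?_)
  have h4 := ncard_image_le (f := fun f => f + Pi.single i (1 : ℝ)) h
  have h5 := ncard_image_le (f := fun f => f + Pi.single i (-1 : ℝ)) h
  omega

omit P [Fintype ι] [DecidableEq ι] in
lemma signedIndicator_of_notMem {A : Set ι} (ε : ι → ℤˣ) {i : ι} (hi : i ∉ A) :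
    signedIndicator A ε i = 0 := indicator_of_notMem hi _

lemma ChainNormal.dotProduct_eq_zero {i : ι} {f : ι → ℝ} (h : ChainNormal i f) {A : Set ι}
    (hA : ∀ k ≤ i, k ∉ A) (ε : ι → ℤˣ) : f ⬝ᵥ signedIndicator A ε = 0 := by
  refine Finset.sum_eq_zero fun k _ => ?_
  by_cases hk : k ≤ i
  · rw [signedIndicator_of_notMem ε (hA k hk), mul_zero]
  · rw [h.eq_zero hk, zero_mul]

omit P in
lemma single_unit_dotProduct_signedIndicator_le (i : ι) (s : ℤˣ) (A : Set ι) (ε : ι → ℤˣ) :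
    Pi.single i ((s : ℤ) : ℝ) ⬝ᵥ signedIndicator A ε ≤ 1 := by
  rw [single_dotProduct]
  by_cases hi : i ∈ A
  · rw [signedIndicator, indicator_of_mem hi]
    rcases intCast_unit_eq s with h | h <;> rcases intCast_unit_eq (ε i) with h' | h' <;>
      simp [h, h']
  · simp [signedIndicator_of_notMem ε hi]

/-- A chain meets an antichain in at most one element. -/
lemma ChainNormal.dotProduct_signedIndicator_le {i : ι} {f : ι → ℝ} (h : ChainNormal i f)
    {A : Set ι} (hA : IsAntichain (· ≤ ·) A) (ε : ι → ℤˣ) : f ⬝ᵥ signedIndicator A ε ≤ 1 := by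
  induction h with
  | min i s _ => exact single_unit_dotProduct_signedIndicator_le i s A ε
  | step i j f s hji hf ih =>
    rw [add_dotProduct]
    by_cases hi : i ∈ A
    · rw [hf.dotProduct_eq_zero, zero_add]
      · exact single_unit_dotProduct_signedIndicator_le i s A ε
      · intro k hk hkA
        have hki := hk.trans_lt hji.lt
        exact hA hkA hi hki.ne hki.le
    · rwa [single_dotProduct, signedIndicator_of_notMem ε hi, mul_zero, add_zero]

/-- Take for `u i` the largest value at `x` of a normal ending at `i`; the free sign at each step
contributes `|x i|`. -/
lemma exists_chain_potential {x : ι → ℝ}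
    (hx : ∀ i, IsMax i → ∀ f, ChainNormal i f → f ⬝ᵥ x ≤ 1) :
    ∃ u : ι → ℝ, (∀ i, |x i| ≤ u i) ∧ (∀ i, u i ≤ 1) ∧ ∀ i j, j < i → u j + |x i| ≤ u i := by
  have hne : ∀ i : ι, ∃ f, ChainNormal i f := by
    intro i
    induction i using WellFoundedLT.induction with
    | _ i ih =>
      by_cases hi : IsMin i
      · exact ⟨_, .min i 1 hi⟩
      · obtain ⟨k, hk⟩ := not_isMin_iff.1 hi
        obtain ⟨j, -, hj⟩ := exists_le_covBy_of_lt hk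
        obtain ⟨f, hf⟩ := ih j hj.lt
        exact ⟨_, .step i j f 1 hj hf⟩
  have hmax : ∀ i, ∃ f, ChainNormal i f ∧ ∀ g, ChainNormal i g → g ⬝ᵥ x ≤ f ⬝ᵥ x := fun i =>
    exists_max_image {f | ChainNormal i f} (· ⬝ᵥ x) (finite_setOf_chainNormal i) (hne i)
  choose f hf hfmax using hmax
  have hcov : ∀ i j, j ⋖ i → f j ⬝ᵥ x + |x i| ≤ f i ⬝ᵥ x := by
    intro i j hji
    have h1 := hfmax i _ (.step i j _ 1 hji (hf j))
    have h2 := hfmax i _ (.step i j _ (-1) hji (hf j))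
    simp only [add_dotProduct, single_dotProduct] at h1 h2
    push_cast at h1 h2
    rcases abs_cases (x i) with h | h <;> linarith
  have habs : ∀ i, |x i| ≤ f i ⬝ᵥ x := by
    intro i
    induction i using WellFoundedLT.induction with
    | _ i ih =>
      by_cases hi : IsMin i
      · have h1 := hfmax i _ (.min i 1 hi)
        have h2 := hfmax i _ (.min i (-1) hi)
        simp only [single_dotProduct] at h1 h2
        push_cast at h1 h2
        rcases abs_cases (x i) with h | h <;> linarith
      · obtain ⟨k, hk⟩ := not_isMin_iff.1 hi
        obtain ⟨j, -, hj⟩ := exists_le_covBy_of_lt hk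
        linarith [(abs_nonneg _).trans (ih j hj.lt), hcov i j hj]
  have hmono : ∀ i j, i ≤ j → f i ⬝ᵥ x ≤ f j ⬝ᵥ x := by
    intro i j
    induction j using WellFoundedLT.induction with
    | _ j ih =>
      intro hij
      rcases hij.eq_or_lt with rfl | hlt
      · rfl
      · obtain ⟨k, hik, hkj⟩ := exists_le_covBy_of_lt hlt
        linarith [ih k hkj.lt hik, hcov j k hkj, abs_nonneg (x j)]
  refine ⟨fun i => f i ⬝ᵥ x, habs, fun i => ?_, fun i j hji => ?_⟩
  · obtain ⟨m, him, hm⟩ := Finite.exists_le_maximal (p := fun _ : ι => True) (a := i) trivial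
    exact (hmono i m him).trans (hx m (maximal_true.1 hm) _ (hf m))
  · obtain ⟨k, hjk, hki⟩ := exists_le_covBy_of_lt hji
    linarith [hcov i k hki, hmono j k hjk]

-- Element `i` is active during an interval of length `|x i|` ending at time `u i`. Intervals of
-- comparable elements are disjoint by `hlt`, so the active set is always an antichain.
omit [DecidableEq ι] in
lemma mem_enrichedChainPolytope_of_potential {x u : ι → ℝ} (habs : ∀ i, |x i| ≤ u i)
    (hle : ∀ i, u i ≤ 1) (hlt : ∀ i j, j < i → u j + |x i| ≤ u i) :
    x ∈ enrichedChainPolytope P := by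
  classical
  let ε : ι → ℤˣ := fun i => if 0 ≤ x i then 1 else -1
  let p : ℝ → ι → ℝ := fun t i =>
    (Ioc (u i - |x i|) (u i)).indicator (fun _ => ((ε i : ℤ) : ℝ)) t
  have hp : ∀ t ∈ Ioc (0 : ℝ) 1, p t ∈
      {x | ∃ (A : Set ι) (ε : ι → ℤˣ), IsAntichain P.le A ∧ x = signedIndicator A ε} := by
    intro t _
    refine ⟨{i | t ∈ Ioc (u i - |x i|) (u i)}, ε, ?_, rfl⟩
    intro i hi j hj hne hij
    have hi' : t ≤ u i := hi.2
    have hj' : u j - |x j| < t := hj.1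
    have hij' : i < j := lt_of_le_of_ne hij hne
    linarith [hlt j i hij']
  have hfin : {x | ∃ (A : Set ι) (ε : ι → ℤˣ),
      IsAntichain P.le A ∧ x = signedIndicator A ε}.Finite := by
    refine (finite_range fun q : Set ι × (ι → ℤˣ) => signedIndicator q.1 q.2).subset ?_
    rintro _ ⟨A, ε, -, rfl⟩
    exact ⟨(A, ε), rfl⟩
  have hint := integral_mem_convexHull hfin (p := p)
    (fun i => integrableOn_indicator_Ioc _ _ _) hp
  have hx : x = fun i => ∫ t in Ioc (0 : ℝ) 1, p t i := by
    ext i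
    simp only [p, ε]
    rw [setIntegral_indicator_Ioc _ (by linarith [habs i]) (by linarith [abs_nonneg (x i)])
      (hle i)]
    split_ifs with h
    · simp [abs_of_nonneg h]
    · simp [abs_of_neg (not_le.1 h)]
  rw [hx]
  exact hint

variable (ι) in
/-- The facet normals of the enriched chain polytope. -/
def chainNormals : Set (ι → ℝ) := {f | ∃ i, IsMax i ∧ ChainNormal i f}

variable (ι) in
open Classical in
lemma chainNormals_eq_iUnion : chainNormals ι =
    ⋃ i ∈ Finset.univ.filter (IsMax : ι → Prop), {f | ChainNormal i f} := by
  ext f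
  simp [chainNormals]

variable (ι) in
open Classical in
lemma ncard_chainNormals_le : (chainNormals ι).ncard ≤
    ∑ i ∈ Finset.univ.filter (IsMax : ι → Prop), {f | ChainNormal i f}.ncard := by
  rw [chainNormals_eq_iUnion]
  exact Finset.set_ncard_biUnion_le _ _

lemma finite_chainNormals : (chainNormals ι).Finite := by
  classical
  rw [chainNormals_eq_iUnion]
  exact (finite_iUnion finite_setOf_chainNormal).subset (iUnion_mono fun j => by simp)

theorem mem_enrichedChainPolytope_iff {x : ι → ℝ} :
    x ∈ enrichedChainPolytope P ↔ ∀ f ∈ chainNormals ι, f ⬝ᵥ x ≤ 1 := by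
  constructor
  · rintro hx f ⟨i, -, hf⟩
    refine dotProduct_le_of_mem_convexHull ?_ x hx
    rintro _ ⟨A, ε, hA, rfl⟩
    exact hf.dotProduct_signedIndicator_le hA ε
  · intro h
    obtain ⟨u, h1, h2, h3⟩ := exists_chain_potential fun i hi f hf => h f ⟨i, hi, hf⟩
    exact mem_enrichedChainPolytope_of_potential h1 h2 h3

variable (ι) in
theorem facets_enrichedChainPolytope_subset :
    facets (enrichedChainPolytope P) ⊆ faceAt (enrichedChainPolytope P) '' chainNormals ι :=
  facets_subset_of_halfspaces finite_chainNormals fun _ => mem_enrichedChainPolytope_iff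

variable (ι) in
lemma finite_facets_enrichedChainPolytope : (facets (enrichedChainPolytope P)).Finite :=
  (finite_chainNormals.image _).subset (facets_enrichedChainPolytope_subset ι)

/-- If any two elements are comparable, then every vector of signs defines a facet. -/
theorem two_pow_le_ncard_facets_of_isChainPoset [Nonempty ι] (hP : IsChainPoset P) :
    2 ^ Fintype.card ι ≤ (facets (enrichedChainPolytope P)).ncard := by
  classical
  set Q := enrichedChainPolytope P
  let w : (ι → ℤˣ) → ι → ℝ := fun ε i => ((ε i : ℤ) : ℝ)
  have hsq : ∀ (ε : ι → ℤˣ) i, w ε i * w ε i = 1 := fun ε i => by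
    rcases intCast_unit_eq (ε i) with h | h <;> simp [w, h]
  have hle : ∀ ε, ∀ x ∈ Q, w ε ⬝ᵥ x ≤ 1 := by
    intro ε
    refine dotProduct_le_of_mem_convexHull ?_
    rintro _ ⟨A, δ, hA, rfl⟩
    by_cases hne : A.Nonempty
    · obtain ⟨i, hi⟩ := hne
      -- In a chain a nonempty antichain is a single point, so the vertices to test are `±e_i` and
      -- 0.
      have : signedIndicator A δ = Pi.single i ((δ i : ℤ) : ℝ) := by
        ext k
        by_cases hk : k ∈ A
        · have hki : k = i := by
            by_contra hki
            rcases hP k i with h | h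
            · exact hA hk hi hki h
            · exact hA hi hk (Ne.symm hki) h
          subst hki
          simp [signedIndicator, hk]
        · rw [signedIndicator_of_notMem _ hk, Pi.single_eq_of_ne]
          rintro rfl
          exact hk hi
      rw [this, dotProduct_single]
      rcases intCast_unit_eq (ε i) with h | h <;> rcases intCast_unit_eq (δ i) with h' | h' <;>
        simp [w, h, h']
    · rw [not_nonempty_iff_eq_empty] at hne
      simp [hne, signedIndicator]
  have hspan : ∀ ε, ∀ g : ι → ℝ, (∀ x ∈ faceAt Q (w ε), g ⬝ᵥ x = 0) → g = 0 := by
    intro ε g hg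
    ext i
    have hx : Pi.single i (w ε i) ∈ Q := by
      refine subset_convexHull _ _ ⟨{i}, ε, IsAntichain.singleton, ?_⟩
      ext k
      by_cases hk : k = i
      · subst hk
        simp [signedIndicator, w]
      · simp [signedIndicator, hk]
    have h := hg _ ⟨hx, by rw [dotProduct_single, hsq]⟩
    rw [dotProduct_single] at h
    have := congrArg (· * w ε i) h
    simp only [mul_assoc, hsq, mul_one, zero_mul] at this
    exact this
  have hinj : Function.Injective fun ε => faceAt Q (w ε) := by
    have hw : Function.Injective w := by
      intro ε δ h
      ext i
      simpa [w] using congrFun h i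
    intro ε δ h
    have := faceAt_injOn (W := range w) (Q := Q) (by rintro _ ⟨ε, rfl⟩; exact hspan ε)
      (mem_range_self ε) (mem_range_self δ) h
    exact hw this
  have hsub : range (fun ε => faceAt Q (w ε)) ⊆ facets Q := by
    rintro _ ⟨ε, rfl⟩
    exact faceAt_mem_facets (vectorSpan_eq_top_of_halfspaces finite_chainNormals fun _ =>
      mem_enrichedChainPolytope_iff) (hle ε) (hspan ε)
  have hcard := ncard_le_ncard hsub (finite_facets_enrichedChainPolytope ι)
  rw [← image_univ, ncard_image_of_injective _ hinj, ncard_univ, Nat.card_eq_fintype_card] at hcard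
  simpa using hcard

end Chain

/-! ### Arithmetic of the two bounds -/

section Bound

/-- The integer form of `orderFacetBound`, with value `1` at `0`. -/
def extremalCount : ℕ → ℕ
  | 0 => 1
  | 1 => 2
  | 2 => 4
  | 3 => 6
  | 4 => 10
  | 5 => 15
  | 6 => 22
  | n + 7 => 3 * (extremalCount (n + 4) + 1)

lemma cast_extremalCount {n : ℕ} (hn : 1 ≤ n) : (extremalCount n : ℚ) = orderFacetBound n := by
  induction n using extremalCount.induct with
  | case1 => omega
  | case2 | case3 | case4 | case5 | case6 | case7 =>
    norm_num [extremalCount, orderFacetBound]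
  | case8 n ih =>
    have hmod : (n + 7) % 3 = (n + 4) % 3 := by omega
    have hdiv : (n + 7) / 3 = (n + 4) / 3 + 1 := by omega
    have h1 : ¬ n + 7 ≤ 3 := by omega
    have h2 : ¬ n + 4 ≤ 3 := by omega
    have h3 : 1 ≤ (n + 4) / 3 := by omega
    rw [extremalCount, Nat.cast_mul, Nat.cast_add, ih (by omega), orderFacetBound, orderFacetBound,
      if_neg h1, if_neg h2, hmod, hdiv]
    obtain ⟨k, hk⟩ := Nat.exists_eq_add_of_le h3
    split_ifs with h4 h5
    · obtain ⟨l, rfl⟩ : ∃ l, k = l + 1 := ⟨k - 1, by omega⟩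
      rw [hk, show 1 + (l + 1) + 1 - 2 = l + 1 by omega, show 1 + (l + 1) - 2 = l by omega]
      push_cast
      ring
    · rw [hk, show 1 + k + 1 - 1 = k + 1 by omega, show 1 + k - 1 = k by omega]
      push_cast
      ring
    · push_cast
      ring

lemma extremalCount_step (n : ℕ) : extremalCount n + 1 ≤ extremalCount (n + 1) ∧
    2 * (1 + extremalCount n) ≤ extremalCount (n + 2) ∧
    3 * (1 + extremalCount n) ≤ extremalCount (n + 3) := by
  induction n using extremalCount.induct with
  -- From argument 4 on, adding 3 applies `x ↦ 3 * (x + 1)`, so the inequalities pass from `n + 4`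
  -- to `n + 7`.
  | case8 n ih =>
    have h0 : extremalCount (n + 7) = 3 * (extremalCount (n + 4) + 1) := by rw [extremalCount]
    have h1 : extremalCount (n + 7 + 1) = 3 * (extremalCount (n + 4 + 1) + 1) := by
      rw [extremalCount]
    have h2 : extremalCount (n + 7 + 2) = 3 * (extremalCount (n + 4 + 2) + 1) := by
      rw [extremalCount]
    have h3 : extremalCount (n + 7 + 3) = 3 * (extremalCount (n + 4 + 3) + 1) := by
      rw [extremalCount]
    change extremalCount (n + 7) + 1 ≤ extremalCount (n + 7 + 1) ∧
      2 * (1 + extremalCount (n + 7)) ≤ extremalCount (n + 7 + 2) ∧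
      3 * (1 + extremalCount (n + 7)) ≤ extremalCount (n + 7 + 3)
    omega
  | _ => simp [extremalCount]

lemma extremalCount_mono : Monotone extremalCount :=
  monotone_nat_of_le_succ fun n => by have := (extremalCount_step n).1; omega

lemma mul_one_add_extremalCount_le (m n : ℕ) (hm : 1 ≤ m) :
    m * (1 + extremalCount n) ≤ extremalCount (n + m) := by
  induction m using Nat.strong_induction_on with
  | _ m ih =>
    rcases lt_or_ge m 4 with h | h
    · have := extremalCount_step n
      interval_cases m <;> omega
    -- A layer of size at least 4 is no better than layers of sizes 2 and `m - 2`, because `m ≤ 2 *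
    -- (m - 2)`.
    · have h1 := ih (m - 2) (by omega) (by omega)
      have h2 := (extremalCount_step (n + (m - 2))).2.1
      rw [show n + (m - 2) + 2 = n + m by omega] at h2
      obtain ⟨k, rfl⟩ : ∃ k, m = k + 4 := ⟨m - 4, by omega⟩
      rw [show k + 4 - 2 = k + 2 by omega] at h1 h2
      nlinarith

lemma mul_two_mul_two_pow_le (m n : ℕ) (hm : 1 ≤ m) : m * (2 * 2 ^ n) ≤ 2 ^ (n + m) := by
  obtain ⟨k, rfl⟩ : ∃ k, m = k + 1 := ⟨m - 1, by omega⟩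
  have h : k + 1 ≤ 2 ^ k := Nat.lt_two_pow_self
  calc (k + 1) * (2 * 2 ^ n) ≤ 2 ^ k * (2 * 2 ^ n) := Nat.mul_le_mul_right _ h
    _ = 2 ^ (n + (k + 1)) := by ring

end Bound

/-! ### Peeling off the maximal elements -/

section Weight

variable {ι : Type*} [PartialOrder ι] [Fintype ι]

open Classical in
/-- A bound for the total weight of the maximal elements, when the weight of an element is bounded
in terms of the total weight of the elements it covers. -/
lemma sum_weight_le {w : ι → ℕ} {φ B : ℕ → ℕ} (hφ : Monotone φ) (hB : Monotone B) (hB0 : 1 ≤ B 0)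
    (hrec : ∀ m n, 1 ≤ m → m * φ (B n) ≤ B (n + m)) (hmin : ∀ i, IsMin i → w i ≤ φ 1)
    (hcov : ∀ i, ¬ IsMin i → w i ≤ φ (∑ j ∈ Finset.univ.filter (· ⋖ i), w j)) [Nonempty ι] :
    ∑ i ∈ Finset.univ.filter (IsMax : ι → Prop), w i ≤ B (Fintype.card ι) := by
  have key : ∀ n (S : Finset ι), S.card = n → S.Nonempty → IsLowerSet (S : Set ι) →
      ∑ i ∈ S.filter (fun i => Maximal (· ∈ S) i), w i ≤ B S.card := by
    intro n
    induction n using Nat.strong_induction_on with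
    | _ n ih =>
      intro S hSn hSne hS
      set M := S.filter (fun i => Maximal (· ∈ S) i) with hM
      have hMS : M ⊆ S := Finset.filter_subset _ _
      have hMne : M.Nonempty := by
        obtain ⟨m, hm⟩ := S.exists_maximal hSne
        exact ⟨m, Finset.mem_filter.2 ⟨hm.1, hm⟩⟩
      have hMpos := hMne.card_pos
      have hcard := Finset.card_sdiff_add_card_eq_card hMS
      have hw : ∀ i ∈ M, w i ≤ φ (B (S \ M).card) := by
        intro i hi
        rw [hM, Finset.mem_filter] at hi
        by_cases himin : IsMin i
        · exact (hmin i himin).trans (hφ (hB0.trans (hB (Nat.zero_le _))))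
        -- The elements strictly below `i` form a smaller lower set avoiding `M`, and its maximal
        -- elements are exactly those covered by `i`. Induction over all lower sets is what makes
        -- this available.
        · set T : Finset ι := Finset.univ.filter (· < i) with hT
          have hTsub : T ⊆ S \ M := by
            intro k hk
            have hki : k < i := by simpa [hT] using hk
            refine Finset.mem_sdiff.2 ⟨hS hki.le hi.1, fun hkM => ?_⟩
            exact (Finset.mem_filter.1 hkM).2.not_gt hi.1 hki
          have hTcard := Finset.card_le_card hTsub
          have hTne : T.Nonempty := by
            obtain ⟨k, hk⟩ := not_isMin_iff.1 himin
            exact ⟨k, by simpa [hT] using hk⟩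
          have hTlow : IsLowerSet (T : Set ι) := by
            intro a b hba ha
            simp only [hT, Finset.coe_filter, Finset.mem_univ, true_and, mem_ofPred_eq] at ha ⊢
            exact hba.trans_lt ha
          have h := ih T.card (by omega) T rfl hTne hTlow
          have hcovers : T.filter (fun k => Maximal (· ∈ T) k) =
              Finset.univ.filter (· ⋖ i) := by
            ext k
            simp only [hT, Finset.mem_filter, Finset.mem_univ, true_and, maximal_iff_forall_gt]
            unfold CovBy
            tauto
          rw [hcovers] at h
          exact (hcov i himin).trans (hφ (h.trans (hB hTcard)))
      calc ∑ i ∈ M, w i ≤ M.card • φ (B (S \ M).card) := Finset.sum_le_card_nsmul _ _ _ hw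
        _ ≤ B ((S \ M).card + M.card) := hrec _ _ hMpos
        _ = B S.card := by rw [hcard]
  have h := key _ Finset.univ rfl Finset.univ_nonempty (by simp [isLowerSet_univ])
  simpa [maximal_true] using h

end Weight

/-! ### Ordinal sums of antichains attain the bound -/

section OrdinalSum

/-- The number of facets of the enriched order polytope of an ordinal sum of antichains of the
given sizes. -/
def ordinalSumCount : List ℕ → ℕ
  | [] => 1
  | a :: L => a * (1 + ordinalSumCount L)

lemma ordinalSumCount_replicate_append (k : ℕ) (L : List ℕ) :
    ordinalSumCount (List.replicate (k + 1) 3 ++ L) =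
      3 * (ordinalSumCount (List.replicate k 3 ++ L) + 1) := by
  rw [List.replicate_succ, List.cons_append, ordinalSumCount, add_comm]

lemma ordinalSumCount_extremalSizes {n : ℕ} (hn : 1 ≤ n) :
    ordinalSumCount (extremalSizes n) = extremalCount n := by
  induction n using extremalCount.induct with
  | case1 => omega
  | case2 | case3 | case4 | case5 | case6 | case7 =>
    simp [extremalCount, extremalSizes, ordinalSumCount]
  | case8 n ih =>
    have hmod : (n + 7) % 3 = (n + 4) % 3 := by omega
    have hdiv : (n + 7) / 3 = (n + 4) / 3 + 1 := by omega
    have h1 : ¬ n + 7 ≤ 3 := by omega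
    have h2 : ¬ n + 4 ≤ 3 := by omega
    rw [extremalCount, ← ih (by omega), extremalSizes, extremalSizes, if_neg h1, if_neg h2, hmod,
      hdiv]
    split_ifs with h4 h5
    · rw [show (n + 4) / 3 + 1 - 2 = (n + 4) / 3 - 2 + 1 by omega,
        ordinalSumCount_replicate_append]
    · rw [show (n + 4) / 3 + 1 - 1 = (n + 4) / 3 - 1 + 1 by omega,
        ordinalSumCount_replicate_append]
    · rw [ordinalSumCount_replicate_append]

lemma sum_extremalSizes (n : ℕ) : (extremalSizes n).sum = n := by
  unfold extremalSizes
  split_ifs <;> simp <;> omega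

lemma pos_of_mem_extremalSizes {n : ℕ} (hn : 1 ≤ n) : ∀ a ∈ extremalSizes n, 0 < a := by
  unfold extremalSizes
  split_ifs <;> simp <;> omega

lemma exists_isOrdinalSumOfAntichains {n : ℕ} {L : List ℕ} (hL : L.sum = n) :
    ∃ P : PartialOrder (Fin n), IsOrdinalSumOfAntichains P L := by
  have hn : ∑ t : Fin L.length, L.get t = n := by
    rw [← hL]
    simp [Fin.sum_univ_getElem]
  subst hn
  -- Cut the index set into consecutive blocks of the prescribed sizes; a larger block index means
  -- lower in the order.
  let e := finSigmaFinEquiv (n := L.get)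
  let level : Fin (∑ t : Fin L.length, L.get t) → Fin L.length := fun i => (e.symm i).1
  let P : PartialOrder (Fin (∑ t : Fin L.length, L.get t)) :=
    { le := fun i j => i = j ∨ level j < level i
      lt := fun i j => level j < level i
      le_refl := fun i => Or.inl rfl
      le_trans := by
        rintro i j k (rfl | hij) (rfl | hjk)
        · exact Or.inl rfl
        · exact Or.inr hjk
        · exact Or.inr hij
        · exact Or.inr (hjk.trans hij)
      lt_iff_le_not_ge := by
        intro i j
        constructor
        · intro h
          refine ⟨Or.inr h, ?_⟩
          rintro (rfl | h')
          · exact lt_irrefl _ h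
          · exact lt_asymm h h'
        · rintro ⟨rfl | h, h'⟩
          · exact (h' (Or.inl rfl)).elim
          · exact h
      le_antisymm := by
        rintro i j (rfl | hij) (h | hji)
        · rfl
        · rfl
        · exact h.symm
        · exact (lt_asymm hij hji).elim }
  refine ⟨P, level, fun i j => Iff.rfl, fun t => ?_⟩
  have : {i | level i = t} = range fun x : Fin (L.get t) => e ⟨t, x⟩ := by
    ext i
    constructor
    · rintro rfl
      exact ⟨(e.symm i).2, by simp [level]⟩
    · rintro ⟨x, rfl⟩
      simp [level]
  rw [this, ← image_univ, ncard_image_of_injective, ncard_univ]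
  · simp
  · intro x y h
    simpa using h

variable {ι : Type*} [P : PartialOrder ι] [DecidableEq ι] [Fintype ι]

/-- As no layer is empty, covers are exactly the pairs in consecutive layers. The number of normals
ending at an element then depends only on its layer. -/
lemma ncard_orderNormals_of_isOrdinalSum {L : List ℕ} (hL : ∀ a ∈ L, 0 < a) [Nonempty ι]
    (hP : IsOrdinalSumOfAntichains P L) : (orderNormals ι).ncard = ordinalSumCount L := by
  classical
  obtain ⟨level, hlt, hcard⟩ := hP
  have hlt' : ∀ i j : ι, i < j ↔ level j < level i := hlt
  have hcard' : ∀ t, (Finset.univ.filter (level · = t)).card = L.get t := by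
    intro t
    rw [← hcard t, ncard_eq_toFinset_card']
    congr 1
    ext
    simp
  have hsurj : ∀ t, ∃ i, level i = t := by
    intro t
    have h := hL _ (L.get_mem t)
    rw [← hcard' t, Finset.card_pos] at h
    obtain ⟨i, hi⟩ := h
    exact ⟨i, by simpa using hi⟩
  have hcov : ∀ i j : ι, j ⋖ i ↔ (level j : ℕ) = level i + 1 := by
    intro i j
    constructor
    · intro h
      have h1 := (hlt' j i).1 h.lt
      rw [Fin.lt_def] at h1
      by_contra hne
      obtain ⟨k, hk⟩ := hsurj ⟨level i + 1, by omega⟩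
      refine h.2 ((hlt' j k).2 ?_) ((hlt' k i).2 ?_) <;> (rw [hk, Fin.lt_def]; simp; try omega)
    · intro h
      refine ⟨(hlt' j i).2 (by rw [Fin.lt_def]; omega), fun k hjk hki => ?_⟩
      have h1 := (hlt' j k).1 hjk
      have h2 := (hlt' k i).1 hki
      rw [Fin.lt_def] at h1 h2
      omega
  have hsum : ∀ (t : ℕ) (ht : t < L.length) (w : ι → ℕ) (c : ℕ),
      (∀ i, (level i : ℕ) = t → w i = c) →
      ∑ i ∈ Finset.univ.filter (fun i => (level i : ℕ) = t), w i = L[t] * c := by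
    intro t ht w c hw
    rw [Finset.sum_congr rfl fun i hi => hw i (by simpa using hi), Finset.sum_const, smul_eq_mul]
    congr 1
    rw [← List.get_eq_getElem (i := ⟨t, ht⟩), ← hcard']
    congr 1
    ext i
    simp [Fin.ext_iff]
  have hw : ∀ i : ι, {f | OrderNormal i f}.ncard =
      1 + ordinalSumCount (L.drop (level i + 1)) := by
    intro i
    induction i using WellFoundedLT.induction with
    | _ i ih =>
      rcases Nat.lt_or_ge (level i + 1) L.length with h | h
      · have hmin : ¬ IsMin i := by
          obtain ⟨k, hk⟩ := hsurj ⟨level i + 1, h⟩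
          refine not_isMin_iff.2 ⟨k, ((hcov i k).2 ?_).lt⟩
          rw [hk]
        rw [ncard_orderNormal_of_not_isMin hmin, List.drop_eq_getElem_cons h, ordinalSumCount,
          Finset.filter_congr fun j _ => hcov i j,
          hsum _ h _ (1 + ordinalSumCount (L.drop (level i + 1 + 1)))]
        intro j hj
        rw [ih j ((hcov i j).2 hj).lt, hj]
      · have hmin : IsMin i := by
          rw [isMin_iff_forall_not_lt]
          intro k hk
          have := (hlt' k i).1 hk
          rw [Fin.lt_def] at this
          omega
        -- The value 1 on the empty list accounts for the two normals `±e_i` at a minimal element.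
        rw [ncard_orderNormal_of_isMin hmin, List.drop_of_length_le h, ordinalSumCount]
  have hlen : 0 < L.length := by
    obtain ⟨i⟩ := ‹Nonempty ι›
    exact (level i).pos
  have hmax : ∀ i : ι, IsMax i ↔ (level i : ℕ) = 0 := by
    intro i
    rw [isMax_iff_forall_not_lt]
    constructor
    · intro h
      obtain ⟨k, hk⟩ := hsurj ⟨0, hlen⟩
      by_contra hne
      exact h k ((hlt' i k).2 (by rw [hk, Fin.lt_def]; simp; omega))
    · intro h k hk
      have := (hlt' i k).1 hk
      rw [Fin.lt_def] at this
      omega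
  rw [ncard_orderNormals, Finset.filter_congr fun i _ => hmax i,
    hsum 0 hlen _ (1 + ordinalSumCount (L.drop 1)) fun i hi => by rw [hw, hi]]
  obtain ⟨a, L', rfl⟩ := List.exists_cons_of_length_pos hlen
  simp [ordinalSumCount]

end OrdinalSum

/-! ### The upper bounds -/

section FacetBounds

variable (ι : Type*) [P : PartialOrder ι] [DecidableEq ι] [Fintype ι] [Nonempty ι]

theorem ncard_facets_enrichedChainPolytope_le :
    (facets (enrichedChainPolytope P)).ncard ≤ 2 ^ Fintype.card ι := by
  classical
  calc (facets (enrichedChainPolytope P)).ncard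
      ≤ (faceAt (enrichedChainPolytope P) '' chainNormals ι).ncard :=
        ncard_le_ncard (facets_enrichedChainPolytope_subset ι) (finite_chainNormals.image _)
    _ ≤ (chainNormals ι).ncard := ncard_image_le finite_chainNormals
    _ ≤ _ := ncard_chainNormals_le ι
    _ ≤ 2 ^ Fintype.card ι :=
        sum_weight_le (φ := (2 * ·)) (B := (2 ^ ·)) (fun a b h => Nat.mul_le_mul_left 2 h)
          (fun a b h => Nat.pow_le_pow_right (by norm_num) h) le_rfl mul_two_mul_two_pow_le
          (fun _ hi => ncard_chainNormal_of_isMin hi)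
          fun _ hi => ncard_chainNormal_of_not_isMin hi

theorem ncard_facets_enrichedOrderPolytope_le :
    (facets (enrichedOrderPolytope P)).ncard ≤ extremalCount (Fintype.card ι) := by
  classical
  rw [ncard_facets_enrichedOrderPolytope, ncard_orderNormals]
  exact sum_weight_le (φ := (1 + ·)) (fun a b h => Nat.add_le_add_left h 1) extremalCount_mono
    le_rfl mul_one_add_extremalCount_le (fun _ hi => (ncard_orderNormal_of_isMin hi).le)
    fun _ hi => (ncard_orderNormal_of_not_isMin hi).le

lemma finite_facets_enrichedOrderPolytope : (facets (enrichedOrderPolytope P)).Finite := by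
  rw [facets_enrichedOrderPolytope]
  exact finite_orderNormals.image _

end FacetBounds

end EnrichedPoset

theorem mainTheorem8 (n : ℕ) (hn : 1 ≤ n) :
    -- the upper bounds
    (∀ P : PartialOrder (Fin n),
      (EnrichedPoset.facets (EnrichedPoset.enrichedChainPolytope P)).Finite ∧
      (EnrichedPoset.facets (EnrichedPoset.enrichedChainPolytope P)).ncard ≤ 2 ^ n ∧
      (EnrichedPoset.facets (EnrichedPoset.enrichedOrderPolytope P)).Finite ∧
      ((EnrichedPoset.facets (EnrichedPoset.enrichedOrderPolytope P)).ncard : ℚ)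
        ≤ EnrichedPoset.orderFacetBound n) ∧
    -- chains attain the first bound
    (∃ P : PartialOrder (Fin n), EnrichedPoset.IsChainPoset P) ∧
    (∀ P : PartialOrder (Fin n), EnrichedPoset.IsChainPoset P →
      (EnrichedPoset.facets (EnrichedPoset.enrichedChainPolytope P)).ncard = 2 ^ n) ∧
    -- ordinal sums of antichains attain the second bound
    (∃ P : PartialOrder (Fin n),
      EnrichedPoset.IsOrdinalSumOfAntichains P (EnrichedPoset.extremalSizes n)) ∧
    (∀ P : PartialOrder (Fin n),
      EnrichedPoset.IsOrdinalSumOfAntichains P (EnrichedPoset.extremalSizes n) →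
      ((EnrichedPoset.facets (EnrichedPoset.enrichedOrderPolytope P)).ncard : ℚ)
        = EnrichedPoset.orderFacetBound n) := by

  have : Nonempty (Fin n) := ⟨⟨0, hn⟩⟩
  refine ⟨fun P => ⟨EnrichedPoset.finite_facets_enrichedChainPolytope (Fin n), ?_,
    EnrichedPoset.finite_facets_enrichedOrderPolytope (Fin n), ?_⟩, ?_, fun P hP => ?_,
    EnrichedPoset.exists_isOrdinalSumOfAntichains (EnrichedPoset.sum_extremalSizes n),
    fun P hP => ?_⟩
  · simpa using EnrichedPoset.ncard_facets_enrichedChainPolytope_le (Fin n)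
  · rw [← EnrichedPoset.cast_extremalCount hn]
    exact_mod_cast by simpa using EnrichedPoset.ncard_facets_enrichedOrderPolytope_le (Fin n)
  · exact ⟨inferInstance, fun i j => le_total i j⟩
  · refine le_antisymm ?_ ?_
    · simpa using EnrichedPoset.ncard_facets_enrichedChainPolytope_le (Fin n)
    · simpa using EnrichedPoset.two_pow_le_ncard_facets_of_isChainPoset hP
  · rw [← EnrichedPoset.cast_extremalCount hn, ← EnrichedPoset.ordinalSumCount_extremalSizes hn,
      EnrichedPoset.ncard_facets_enrichedOrderPolytope (Fin n),
      EnrichedPoset.ncard_orderNormals_of_isOrdinalSum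
        (EnrichedPoset.pos_of_mem_extremalSizes hn) hP]
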